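/- Let $A=\mathbb Z\{X,Y\}$ be the free associative unital ring on two generators and let $p=2$. For a ring $R$ write $[R,R]$ for the additive subgroup generated by the commutators $ab-ba$. Let $W(A)=\varprojlim_n W_n(A)$ be Hesselholt's topological group of $p$-typical Witt vectors ($W_n(A)$ discrete), with its map $q:A^{\mathbb N_0}\to W(A)$, Verschiebung $V\,q(a_0,a_1,\dots)=q(0,a_0,a_1,\dots)$ and Teichmüller map $\langle a\rangle=q(a,0,0,\dots)$. Here $W_n(A)$ is constructed as follows: let $F\to A$ be the free ring on the set $A$, let $\omega:F^n\to (F/[F,F])^n$ be the ghost map $\omega_i(x_0,\dots,x_i)=\sum_{j\le i}p^jx_j^{p^{i-j}}$, and let $W_n(F)$ be the group generated by the image of $\omega$; then $W_n(A)$ is the quotient of $W_n(F)$ by the subgroup generated by all $\omega(x)-\omega(y)$ such that $x,y\in F^n$ have the same image in $A^n$, and $(a_0,\dots,a_{n-1})\in A^n$ is sent to the class of $\omega(x)$ for any lift $x\in F^n$. For a ring $R$ give $R^{\mathbb N_0}$ the product topology of the discrete topology, and put $V(x_0,x_1,\dots)=p\,(0,x_0,x_1,\dots)$ and $\langle a\rangle=(a,a^p,a^{p^2},\dots)$.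 Let $X(R)\subset R^{\mathbb N_0}$ be the closed subgroup generated by all $V^m(\langle a_1\rangle\cdots\langle a_r\rangle)$ with $m\ge 0$, $r\ge 1$, $a_i\in R$; it is a subring. For a two-sided ideal $I\subset R$ let $X(I)$ be the closed subgroup generated by those $V^m(\langle a_1\rangle\cdots\langle a_r\rangle)$ in which at least one $a_i$ lies in $I$; it is a two-sided ideal of $X(R)$. Let $\mathbb ZA$ be the monoid ring of the multiplicative monoid of $A$, let $I$ be the kernel of $\mathbb ZA\to A$, $[a]\mapsto a$, and let $E(A)=X(\mathbb ZA)/X(I)$ be the topological ring of Cuntz and Deninger, with the induced operator $V$ and the Teichmüller map $\langle a\rangle=\langle[a]\rangle \bmod X(I)$. Let $HH_0(E(A))=E(A)/\overline{[E(A),E(A)]}$ with the quotient topology. Then there is no continuous group homomorphism $\Phi:W(A)\to HH_0(E(A))$ that is compatible with the Teichmüller maps and with $V$, i.e. such that 1. for every $a\in A$, $\Phi(\langle a\rangle)$ is the class of $\langle a\rangle\in E(A)$, and 2. every $w\in W(A)$ has the property that $\Phi(w)$ is the class of some $e\in E(A)$ for which $\Phi(Vw)$ is the class of $Ve$. (If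 $V$ descends to a map of $HH_0(E(A))$, then condition 2 says exactly that $\Phi\circ V=V\circ\Phi$.) -/

import Mathlib

/-! ### Commutator quotients -/

/-- `[R, R]`: the additive subgroup of `R` generated by all commutators `a b - b a`. -/
def commutatorSubgroup (R : Type*) [Ring R] : AddSubgroup R :=
  AddSubgroup.closure {x | ∃ a b : R, x = a * b - b * a}

/-- The abelian group `R / [R, R]`. -/
abbrev Cocenter (R : Type*) [Ring R] : Type _ := R ⧸ commutatorSubgroup R

/-! ### Hesselholt's group `W(A)` -/

namespace Hesselholt

/-- The ghost map `Rⁿ → (R / [R, R])ⁿ`, whose `i`-th component is the class of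
`a₀ ^ (p ^ i) + p a₁ ^ (p ^ (i - 1)) + ⋯ + p ^ i aᵢ`. -/
def ghost (p : ℕ) {R : Type*} [Ring R] (n : ℕ) (a : Fin n → R) : Fin n → Cocenter R :=
  fun i => QuotientAddGroup.mk
    (∑ j ∈ Finset.Iic i, (p : R) ^ (j : ℕ) * a j ^ p ^ ((i : ℕ) - (j : ℕ)))

/-- The ring homomorphism from the free ring on the set `A` onto `A`. -/
def freeCover (A : Type*) [Ring A] : FreeAlgebra ℤ A →+* A :=
  (FreeAlgebra.lift ℤ (id : A → A)).toRingHom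

/-- `Wₙ(F)` for the free ring `F` on the set `A`. Since `F / [F, F]` is torsion free, the ghost
map is injective on `Wₙ(F)`, and `Wₙ(F)` is the group formed by the ghost vectors. -/
def wittFree (p : ℕ) (A : Type*) [Ring A] (n : ℕ) :
    AddSubgroup (Fin n → Cocenter (FreeAlgebra ℤ A)) :=
  AddSubgroup.closure (Set.range (ghost p n))

/-- The subgroup generated by the differences of the ghost vectors of two elements of `Fⁿ` that
have the same image in `Aⁿ`. -/
def wittRel (p : ℕ) (A : Type*) [Ring A] (n : ℕ) :
    AddSubgroup (Fin n → Cocenter (FreeAlgebra ℤ A)) :=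
  AddSubgroup.closure {z | ∃ x y : Fin n → FreeAlgebra ℤ A,
    (∀ i, freeCover A (x i) = freeCover A (y i)) ∧ z = ghost p n x - ghost p n y}

/-- The group `Wₙ(A)` of `p`-typical Witt vectors of length `n` of a possibly non-commutative
ring `A`: the group `Wₙ(F)` of the free ring `F` on the set `A`, in which the classes of two
elements of `Fⁿ` are identified as soon as the two elements have the same image in `Aⁿ`. -/
def WittN (p : ℕ) (A : Type*) [Ring A] (n : ℕ) : Type _ :=
  wittFree p A n ⧸ (wittRel p A n).addSubgroupOf (wittFree p A n)

section

variable (p : ℕ) {A : Type*} [Ring A]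

instance (n : ℕ) : AddCommGroup (WittN p A n) :=
  inferInstanceAs
    (AddCommGroup (wittFree p A n ⧸ (wittRel p A n).addSubgroupOf (wittFree p A n)))

/-- `Wₙ(A)` is discrete. -/
instance (n : ℕ) : TopologicalSpace (WittN p A n) := ⊥

instance (n : ℕ) : DiscreteTopology (WittN p A n) := ⟨rfl⟩

/-- The map `qₙ : Aⁿ → Wₙ(A)`; by construction the choice of the lifts to the free ring does not
matter. -/
def qN (n : ℕ) (a : Fin n → A) : WittN p A n :=
  QuotientAddGroup.mk (s := (wittRel p A n).addSubgroupOf (wittFree p A n))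
    ⟨ghost p n fun i => FreeAlgebra.ι ℤ (a i), AddSubgroup.subset_closure ⟨_, rfl⟩⟩

/-- A homomorphism of the groups of ghost vectors that is induced by a map `Fⁿ → Fᵐ` which
respects the congruence of lifts induces a homomorphism `Wₙ(A) → Wₘ(A)`. -/
def WittN.map {n m : ℕ}
    (φ : (Fin n → Cocenter (FreeAlgebra ℤ A)) →+ (Fin m → Cocenter (FreeAlgebra ℤ A)))
    (f : (Fin n → FreeAlgebra ℤ A) → (Fin m → FreeAlgebra ℤ A))
    (hf : ∀ x y, (∀ i, freeCover A (x i) = freeCover A (y i)) →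
      ∀ i, freeCover A (f x i) = freeCover A (f y i))
    (h : ∀ x, φ (ghost p n x) = ghost p m (f x)) : WittN p A n →+ WittN p A m :=
  QuotientAddGroup.map _ _
    ((φ.comp (wittFree p A n).subtype).codRestrict (wittFree p A m) (by
      rintro ⟨z, hz⟩
      have : wittFree p A n ≤ (wittFree p A m).comap φ := by
        refine (AddSubgroup.closure_le _).2 ?_
        rintro _ ⟨x, rfl⟩
        exact AddSubgroup.subset_closure ⟨f x, (h x).symm⟩
      exact this hz))
    (by
      rintro ⟨z, hz⟩ hr
      have : wittRel p A n ≤ (wittRel p A m).comap φ := by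
        refine (AddSubgroup.closure_le _).2 ?_
        rintro _ ⟨x, y, hxy, rfl⟩
        exact AddSubgroup.subset_closure ⟨f x, f y, hf x y hxy, by rw [map_sub, h, h]⟩
      exact this hr)

theorem ghost_castSucc {R : Type*} [Ring R] (n : ℕ) (a : Fin (n + 1) → R) (i : Fin n) :
    ghost p (n + 1) a i.castSucc = ghost p n (fun j => a j.castSucc) i := by
  unfold ghost
  congr 1
  have : Finset.Iic i.castSucc = (Finset.Iic i).map Fin.castSuccEmb := by
    simp
  rw [this, Finset.sum_map]
  rfl

theorem ghost_cons {R : Type*} [Ring R] (n : ℕ) (hp : p ≠ 0) (a : Fin n → R) :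
    ghost p (n + 1) (Fin.cons 0 a) = Fin.cons 0 (p • ghost p n a) := by
  funext i
  refine Fin.cases ?_ (fun i => ?_) i
  · unfold ghost
    have : Finset.Iic (0 : Fin (n + 1)) = {0} := by ext j; simp
    rw [this]
    simp
  · have : Finset.Iic i.succ = insert 0 ((Finset.Iic i).map (Fin.succEmb n)) := by
      ext j
      refine Fin.cases ?_ (fun j => ?_) j <;> simp
    simp only [ghost, this, Fin.cons_succ, Pi.smul_apply]
    rw [Finset.sum_insert (by simp), Finset.sum_map, ← QuotientAddGroup.mk_nsmul]
    congr 1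
    simp [hp, Finset.mul_sum, pow_succ', mul_assoc]

/-- The restriction `Wₙ₊₁(A) → Wₙ(A)`, `(a₀, …, aₙ) ↦ (a₀, …, aₙ₋₁)`. -/
def restrict (n : ℕ) : WittN p A (n + 1) →+ WittN p A n :=
  WittN.map p
    { toFun := fun z i => z i.castSucc
      map_zero' := rfl
      map_add' := fun _ _ => rfl }
    (fun x i => x i.castSucc) (fun _ _ h i => h i.castSucc)
    (fun x => funext fun i => ghost_castSucc p n x i)

/-- The Verschiebung `Wₙ(A) → Wₙ₊₁(A)`, `(a₀, …, aₙ₋₁) ↦ (0, a₀, …, aₙ₋₁)`; on ghost vectors it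
is `(x₀, …, xₙ₋₁) ↦ (0, p x₀, …, p xₙ₋₁)`. -/
def verschiebungN [hp : Fact p.Prime] (n : ℕ) : WittN p A n →+ WittN p A (n + 1) :=
  WittN.map p
    { toFun := fun z => Fin.cons 0 (p • z)
      map_zero' := by
        funext i
        refine Fin.cases ?_ (fun i => ?_) i <;> simp
      map_add' := fun z w => by
        funext i
        refine Fin.cases ?_ (fun i => ?_) i <;> simp [nsmul_add] }
    (fun x => Fin.cons 0 x)
    (fun x y h i => by
      refine Fin.cases ?_ (fun i => ?_) i
      · simp
      · simpa using h i)
    (fun x => (ghost_cons p n hp.out.ne_zero x).symm)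

theorem restrict_qN (n : ℕ) (a : Fin (n + 1) → A) :
    restrict p n (qN p (n + 1) a) = qN p n fun i => a i.castSucc := by
  refine congrArg (QuotientAddGroup.mk (s := (wittRel p A n).addSubgroupOf (wittFree p A n)))
    (Subtype.ext (funext fun i => ?_))
  exact ghost_castSucc p n _ i

theorem restrict_verschiebungN [Fact p.Prime] (n : ℕ) (w : WittN p A (n + 1)) :
    restrict p (n + 1) (verschiebungN p (n + 1) w) = verschiebungN p n (restrict p n w) := by
  obtain ⟨z, rfl⟩ := QuotientAddGroup.mk_surjective w
  refine congrArg (QuotientAddGroup.mk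
    (s := (wittRel p A (n + 1)).addSubgroupOf (wittFree p A (n + 1))))
    (Subtype.ext (funext fun i => ?_))
  refine Fin.cases rfl (fun i => rfl) i

end

/-- `W(A)`, the inverse limit of the groups `Wₙ(A)` along the restriction maps. Its topology is
the inverse limit topology, the subspace topology of the product of the discrete `Wₙ(A)`. -/
def Witt (p : ℕ) (A : Type*) [Ring A] : AddSubgroup (∀ n, WittN p A n) where
  carrier := {w | ∀ n, restrict p n (w (n + 1)) = w n}
  zero_mem' := fun n => map_zero _
  add_mem' := fun {v w} hv hw n => by
    rw [Pi.add_apply, Pi.add_apply, map_add, hv n, hw n]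
  neg_mem' := fun {v} hv n => by
    rw [Pi.neg_apply, Pi.neg_apply, map_neg, hv n]

section

variable (p : ℕ) {A : Type*} [Ring A]

/-- The map `q : A^ℕ → W(A)`. -/
def q (a : ℕ → A) : Witt p A :=
  ⟨fun n => qN p n fun i => a i, fun n => restrict_qN p n fun i => a i⟩

/-- The Teichmüller map `A → W(A)`, `a ↦ (a, 0, 0, …)`. -/
def teichmuller (a : A) : Witt p A := q p fun i => if i = 0 then a else 0

/-- The Verschiebung `W(A) → W(A)`, `(a₀, a₁, …) ↦ (0, a₀, a₁, …)`. -/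
def verschiebung [Fact p.Prime] : Witt p A →+ Witt p A where
  toFun w := ⟨fun n => Nat.casesOn n 0 fun k => verschiebungN p k (w.1 k), fun n => by
    cases n with
    | zero => exact Subsingleton.elim (h := ⟨fun x y => by
        obtain ⟨x, rfl⟩ := QuotientAddGroup.mk_surjective x
        obtain ⟨y, rfl⟩ := QuotientAddGroup.mk_surjective y
        exact congrArg _ (Subtype.ext (Subsingleton.elim _ _))⟩) _ _
    | succ k => exact (restrict_verschiebungN p k _).trans (congrArg _ (w.2 k))⟩
  map_zero' := Subtype.ext (funext fun n => by
    cases n with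
    | zero => rfl
    | succ k => exact map_zero _)
  map_add' v w := Subtype.ext (funext fun n => by
    cases n with
    | zero => exact (add_zero _).symm
    | succ k => exact map_add _ _ _)

end

end Hesselholt

/-! ### The ring `E(A)` of Cuntz and Deninger -/

namespace CuntzDeninger

/-- The ring `R^ℕ` of sequences in `R`, with componentwise operations. -/
def Seq (R : Type*) : Type _ := ℕ → R

section

variable {R : Type*} [Ring R]

instance : Ring (Seq R) := inferInstanceAs (Ring (ℕ → R))

/-- `R^ℕ` carries the product topology of the discrete topology of `R`. -/
instance : TopologicalSpace (Seq R) := @Pi.topologicalSpace ℕ (fun _ => R) fun _ => ⊥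

instance : IsTopologicalRing (Seq R) := by
  let _ : TopologicalSpace R := ⊥
  have _ : DiscreteTopology R := ⟨rfl⟩
  exact inferInstanceAs (IsTopologicalRing (ℕ → R))

/-- The Verschiebung of `R^ℕ`, `V (a₀, a₁, …) = p (0, a₀, a₁, …)`. -/
def V (p : ℕ) : Seq R →+ Seq R where
  toFun x := fun n => Nat.casesOn n 0 fun k => (p : R) * x k
  map_zero' := funext fun n => by
    cases n with
    | zero => rfl
    | succ k => exact mul_zero _
  map_add' x y := funext fun n => by
    cases n with
    | zero => exact (add_zero _).symm
    | succ k => exact mul_add _ _ _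

/-- `⟨a⟩ = (a, a ^ p, a ^ (p ^ 2), …)` in `R^ℕ`. -/
def teich (p : ℕ) (a : R) : Seq R := fun n => a ^ p ^ n

/-- The elements `V ^ m (⟨a₁⟩ ⋯ ⟨aᵣ⟩)` with `m ≥ 0`, `r ≥ 1` and `a₁, …, aᵣ` in `R`, at least
one of them in `I`. -/
def gens (p : ℕ) (I : Ideal R) : Set (Seq R) :=
  {x | ∃ (m : ℕ) (l : List R), (∃ a ∈ l, a ∈ I) ∧ x = (V p)^[m] (l.map (teich p)).prod}

/-- The closed subgroup of `R^ℕ` generated by `gens p I`. For `I = R` it is the closed subgroup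
generated by all `V ^ m (⟨a₁⟩ ⋯ ⟨aᵣ⟩)` with `r ≥ 1`. -/
def closedSpan (p : ℕ) (I : Ideal R) : AddSubgroup (Seq R) :=
  (AddSubgroup.closure (gens p I)).topologicalClosure

theorem continuous_V (p : ℕ) : Continuous (V p : Seq R → Seq R) := by
  let _ : TopologicalSpace R := ⊥
  have _ : DiscreteTopology R := ⟨rfl⟩
  refine continuous_pi fun n => ?_
  cases n with
  | zero => exact continuous_const
  | succ k =>
    have h : Continuous fun r : R => (p : R) * r := continuous_of_discreteTopology
    have h' : Continuous fun x : ℕ → R => x k := continuous_apply k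
    exact h.comp h'

theorem V_mem_closure (p : ℕ) (I : Ideal R) {x : Seq R}
    (hx : x ∈ AddSubgroup.closure (gens p I)) : V p x ∈ AddSubgroup.closure (gens p I) := by
  have : AddSubgroup.closure (gens p I) ≤ (AddSubgroup.closure (gens p I)).comap (V p) := by
    refine (AddSubgroup.closure_le _).2 ?_
    rintro _ ⟨m, l, hl, rfl⟩
    exact AddSubgroup.subset_closure ⟨m + 1, l, hl, (Function.iterate_succ_apply' _ _ _).symm⟩
  exact this hx

theorem V_mem_closedSpan (p : ℕ) (I : Ideal R) {x : Seq R} (hx : x ∈ closedSpan p I) :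
    V p x ∈ closedSpan p I :=
  map_mem_closure (continuous_V p) hx fun _ hy => V_mem_closure p I hy

theorem gens_mem_closedSpan {p : ℕ} {I : Ideal R} {x : Seq R} (hx : x ∈ gens p I) :
    x ∈ closedSpan p I :=
  AddSubgroup.le_topologicalClosure _ (AddSubgroup.subset_closure hx)

theorem prod_teich_succ (p : ℕ) (l : List R) (k : ℕ) :
    (l.map (teich p)).prod (k + 1) = ((l.map (· ^ p)).map (teich p)).prod k := by
  induction l with
  | nil => rfl
  | cons a l ihl =>
    simp only [List.map_cons, List.prod_cons]
    refine congrArg₂ (· * ·) ?_ ihl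
    change a ^ p ^ (k + 1) = (a ^ p) ^ p ^ k
    rw [← pow_mul, pow_succ']

theorem map_pow_map_pow (p n : ℕ) (l : List R) :
    (l.map (· ^ p)).map (· ^ p ^ n) = l.map (· ^ p ^ (n + 1)) := by
  rw [List.map_map]
  refine List.map_congr_left fun a _ => ?_
  change (a ^ p) ^ p ^ n = a ^ p ^ (n + 1)
  rw [← pow_mul, pow_succ']

theorem iterate_V_mul (p n : ℕ) (l : List R) (y : Seq R) :
    (V p)^[n] y * (l.map (teich p)).prod =
      (V p)^[n] (y * ((l.map (· ^ p ^ n)).map (teich p)).prod) := by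
  induction n generalizing l with
  | zero => simp
  | succ n ih =>
    have key : ∀ z : Seq R, V p z * (l.map (teich p)).prod =
        V p (z * ((l.map (· ^ p)).map (teich p)).prod) := by
      intro z
      funext k
      cases k with
      | zero => exact zero_mul _
      | succ k =>
        change ((p : R) * z k) * (l.map (teich p)).prod (k + 1) = (p : R) * (z k * _)
        rw [prod_teich_succ, mul_assoc]
    rw [Function.iterate_succ_apply', key, ih, ← Function.iterate_succ_apply' (V p),
      map_pow_map_pow]

theorem mul_iterate_V (p n : ℕ) (l : List R) (y : Seq R) :
    (l.map (teich p)).prod * (V p)^[n] y =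
      (V p)^[n] (((l.map (· ^ p ^ n)).map (teich p)).prod * y) := by
  induction n generalizing l with
  | zero => simp
  | succ n ih =>
    have key : ∀ z : Seq R, (l.map (teich p)).prod * V p z =
        V p (((l.map (· ^ p)).map (teich p)).prod * z) := by
      intro z
      funext k
      cases k with
      | zero => exact mul_zero _
      | succ k =>
        change (l.map (teich p)).prod (k + 1) * ((p : R) * z k) = (p : R) * (_ * z k)
        rw [prod_teich_succ, (Nat.cast_commute p _).symm.left_comm]
    rw [Function.iterate_succ_apply', key, ih, ← Function.iterate_succ_apply' (V p),
      map_pow_map_pow]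

theorem V_mul_V (p : ℕ) (x y : Seq R) : V p x * V p y = p • V p (x * y) := by
  funext k
  cases k with
  | zero => exact (mul_zero _).trans (nsmul_zero _).symm
  | succ k =>
    change ((p : R) * x k) * ((p : R) * y k) = p • ((p : R) * (x k * y k))
    rw [nsmul_eq_mul, mul_assoc, (Nat.cast_commute p (x k)).symm.left_comm]

theorem mul_mem_closedSpan (p : ℕ) (I J K : Ideal R)
    (hK : ∀ a b : R, a ∈ I → b ∈ J → (∀ n, a ^ p ^ n ∈ K) ∨ (∀ n, b ^ p ^ n ∈ K))
    {x y : Seq R} (hx : x ∈ closedSpan p I) (hy : y ∈ closedSpan p J) :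
    x * y ∈ closedSpan p K := by
  have hgen : ∀ (m n : ℕ) (l l' : List R), (∃ a ∈ l, a ∈ I) → (∃ b ∈ l', b ∈ J) →
      (V p)^[m] (l.map (teich p)).prod * (V p)^[n] (l'.map (teich p)).prod ∈
        AddSubgroup.closure (gens p K) := by
    intro m
    induction m with
    | zero =>
      rintro n l l' ⟨a, hal, ha⟩ ⟨b, hbl, hb⟩
      refine AddSubgroup.subset_closure ⟨n, l.map (· ^ p ^ n) ++ l', ?_, ?_⟩
      · rcases hK a b ha hb with h | h
        · exact ⟨a ^ p ^ n, List.mem_append_left _ (List.mem_map_of_mem hal), h n⟩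
        · exact ⟨b, List.mem_append_right _ hbl, by simpa using h 0⟩
      · rw [Function.iterate_zero_apply, mul_iterate_V, List.map_append, List.prod_append]
    | succ m ih =>
      rintro n l l' hl hl'
      cases n with
      | zero =>
        obtain ⟨a, hal, ha⟩ := hl
        obtain ⟨b, hbl, hb⟩ := hl'
        refine AddSubgroup.subset_closure ⟨m + 1, l ++ l'.map (· ^ p ^ (m + 1)), ?_, ?_⟩
        · rcases hK a b ha hb with h | h
          · exact ⟨a, List.mem_append_left _ hal, by simpa using h 0⟩
          · exact ⟨b ^ p ^ (m + 1), List.mem_append_right _ (List.mem_map_of_mem hbl), h _⟩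
        · rw [Function.iterate_zero_apply, iterate_V_mul, List.map_append, List.prod_append]
      | succ n =>
        rw [Function.iterate_succ_apply', Function.iterate_succ_apply', V_mul_V]
        exact AddSubgroup.nsmul_mem _ (V_mem_closure p K (ih n l l' hl hl')) _
  refine map_mem_closure₂ continuous_mul hx hy fun u hu v hv => ?_
  have h₁ : ∀ (m : ℕ) (l : List R), (∃ a ∈ l, a ∈ I) → ∀ w ∈ AddSubgroup.closure (gens p J),
      (V p)^[m] (l.map (teich p)).prod * w ∈ AddSubgroup.closure (gens p K) := by
    intro m l hl w hw
    induction hw using AddSubgroup.closure_induction with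
    | mem w hw =>
      obtain ⟨n, l', hl', rfl⟩ := hw
      exact hgen m n l l' hl hl'
    | zero => rw [mul_zero]; exact zero_mem _
    | add a b _ _ ha hb => rw [mul_add]; exact add_mem ha hb
    | neg a _ ha => rw [mul_neg]; exact neg_mem ha
  change u ∈ AddSubgroup.closure (gens p I) at hu
  change v ∈ AddSubgroup.closure (gens p J) at hv
  change u * v ∈ AddSubgroup.closure (gens p K)
  induction hu using AddSubgroup.closure_induction with
  | mem w hw =>
    obtain ⟨m, l, hl, rfl⟩ := hw
    exact h₁ m l hl v hv
  | zero => rw [zero_mul]; exact zero_mem _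
  | add a b _ _ ha hb => rw [add_mul]; exact add_mem ha hb
  | neg a _ ha => rw [neg_mul]; exact neg_mem ha

theorem pow_mem_ideal (p : ℕ) [hp : Fact p.Prime] (I : Ideal R) {a : R} (ha : a ∈ I) (n : ℕ) :
    a ^ p ^ n ∈ I := by
  obtain ⟨k, hk⟩ := Nat.exists_eq_succ_of_ne_zero (pow_pos hp.out.pos n).ne'
  rw [hk, pow_succ]
  exact I.mul_mem_left _ ha

end

section

variable (p : ℕ) (R : Type*) [Ring R]

/-- `X(R) ⊆ R^ℕ`: the closed subgroup generated by all `V ^ m (⟨a₁⟩ ⋯ ⟨aᵣ⟩)` with `m ≥ 0`,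
`r ≥ 1`, `aᵢ ∈ R`. It is a subring. -/
def X : Subring (Seq R) :=
  { closedSpan p (⊤ : Ideal R) with
    mul_mem' := fun hx hy => mul_mem_closedSpan p ⊤ ⊤ ⊤ (fun _ _ _ _ => Or.inl fun _ => trivial)
      hx hy
    one_mem' := gens_mem_closedSpan ⟨0, [1], ⟨1, List.mem_singleton_self 1, trivial⟩, by
      rw [Function.iterate_zero_apply, List.map_singleton, List.prod_singleton]
      exact funext fun n => (one_pow _).symm⟩ }

variable {R} [Fact p.Prime]

/-- `X(I) ⊆ X(R)` for a two-sided ideal `I` of `R`: the closed subgroup generated by all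
`V ^ m (⟨a₁⟩ ⋯ ⟨aᵣ⟩)` with `m ≥ 0`, `r ≥ 1`, `aᵢ ∈ R` and at least one `aᵢ` in `I`. It is an
ideal. -/
def XI (I : Ideal R) : Ideal (X p R) where
  carrier := {x | (x : Seq R) ∈ closedSpan p I}
  zero_mem' := zero_mem (closedSpan p I)
  add_mem' := fun hx hy => (closedSpan p I).add_mem hx hy
  smul_mem' := fun c _ hx => mul_mem_closedSpan p ⊤ I I
    (fun _ _ _ hb => Or.inr fun n => pow_mem_ideal p I hb n) c.2 hx

/-- The ideal `X(I)` is two-sided. -/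
instance (I : Ideal R) : (XI p I).IsTwoSided where
  mul_mem_of_left := fun {a} b hx => by
    change (a : Seq R) ∈ closedSpan p I at hx
    exact mul_mem_closedSpan p I ⊤ I
      (fun _ _ ha _ => Or.inl fun n => pow_mem_ideal p I ha n) hx b.2

/-- The Verschiebung of `X(R)`. -/
def XV : X p R →+ X p R where
  toFun x := ⟨V p x.1, V_mem_closedSpan p ⊤ x.2⟩
  map_zero' := Subtype.ext (map_zero (V p))
  map_add' x y := Subtype.ext (map_add (V p) x.1 y.1)

end

/-- The natural ring homomorphism `ℤA → A`, `∑ nₐ [a] ↦ ∑ nₐ a`, from the monoid algebra of the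
multiplicative monoid of `A`. -/
noncomputable def augment (A : Type*) [Ring A] : MonoidAlgebra ℤ A →+* A :=
  (MonoidAlgebra.lift ℤ A A (MonoidHom.id A)).toRingHom

/-- `E(A) = X(ℤA) / X(I)`, where `I` is the kernel of `ℤA → A`. -/
noncomputable def E (p : ℕ) [Fact p.Prime] (A : Type*) [Ring A] : Type _ :=
  X p (MonoidAlgebra ℤ A) ⧸ XI p (RingHom.ker (augment A))

section

variable (p : ℕ) [Fact p.Prime] {A : Type*} [Ring A]

noncomputable instance : Ring (E p A) :=
  inferInstanceAs (Ring (X p (MonoidAlgebra ℤ A) ⧸ XI p (RingHom.ker (augment A))))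

/-- The quotient map `X(ℤA) → E(A)`. -/
noncomputable def toE : X p (MonoidAlgebra ℤ A) →+* E p A :=
  Ideal.Quotient.mk (XI p (RingHom.ker (augment A)))

/-- `E(A)` carries the quotient topology. -/
noncomputable instance : TopologicalSpace (E p A) := TopologicalSpace.coinduced (toE p) inferInstance

instance : IsTopologicalAddGroup (E p A) :=
  inferInstanceAs (IsTopologicalAddGroup
    (X p (MonoidAlgebra ℤ A) ⧸ (XI p (RingHom.ker (augment A))).toAddSubgroup))

/-- The Verschiebung `E(A) → E(A)`. -/
noncomputable def verschiebung : E p A →+ E p A :=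
  QuotientAddGroup.map (XI p (RingHom.ker (augment A))).toAddSubgroup
    (XI p (RingHom.ker (augment A))).toAddSubgroup (XV p)
    fun x hx => by
      change (x : Seq (MonoidAlgebra ℤ A)) ∈ closedSpan p _ at hx
      exact V_mem_closedSpan p (RingHom.ker (augment A)) hx

/-- The Teichmüller map `A → E(A)`, `a ↦ ([a], [a] ^ p, [a] ^ (p ^ 2), …)`. -/
noncomputable def teichmuller (a : A) : E p A :=
  toE p ⟨teich p (MonoidAlgebra.of ℤ A a),
    gens_mem_closedSpan ⟨0, [MonoidAlgebra.of ℤ A a], ⟨_, List.mem_singleton_self _, trivial⟩, by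
      rw [Function.iterate_zero_apply, List.map_singleton, List.prod_singleton]⟩⟩

end

/-- `HH₀(E(A))`: the quotient of `E(A)` by the closure of `[E(A), E(A)]`, with the quotient
topology. -/
noncomputable abbrev HH0E (p : ℕ) [Fact p.Prime] (A : Type*) [Ring A] : Type _ :=
  E p A ⧸ (commutatorSubgroup (E p A)).topologicalClosure

/-- The quotient map `E(A) → HH₀(E(A))`. -/
noncomputable abbrev toHH0E (p : ℕ) [Fact p.Prime] {A : Type*} [Ring A] : E p A →+ HH0E p A :=
  QuotientAddGroup.mk' _

end CuntzDeninger

/-! ### Orbits of the rotation of words -/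

/-! In `W(A)` the defect `⟨X + Y⟩ - ⟨X⟩ - ⟨Y⟩` lies in the closure of the image of `V`, whereas in
`HH₀(E(A))` a continuous invariant separates it from all classes of elements `V e`.

For the first half, expand `(x + y) ^ 2 ^ n` into words. Modulo commutators a word depends only on
its rotation class; grouping the words by primitive root gives `x ^ 2 ^ n + y ^ 2 ^ n` plus terms `2
^ (j + 1) u ^ 2 ^ (n - (j + 1))` (`exists_add_pow_two_pow`). These are the ghost components of `V ^
(j + 1) ⟨u⟩`, and the words `u` do not depend on `n`; so the defect is a convergent sum of such
elements (`exists_tendsto_verschiebung`).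

For the second half, map a sequence in `ℤA` to its entry of index 1, then to `A`, then by
`unitriangularRep` to matrices over `𝔽₂` (`component`). There `V` becomes multiplication by 2, hence
zero, and `⟨a⟩` becomes the square of a matrix. Such squares are central in the image of the
representation, so commutators die and the map descends to `componentHH0`. The defect goes to the
image of `XY + YX`, which is the nonzero matrix unit at `(0, 2)`. -/

theorem exists_orbit_representatives {α M : Type*} [AddCommMonoid M] (σ : α → α) (m : ℕ)
    (hm : 0 < m) (S : Finset α) (hS : ∀ s ∈ S, σ s ∈ S)
    (hper : ∀ s ∈ S, Function.minimalPeriod σ s = m) :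
    ∃ B ⊆ S, ∀ H : α → M, (∀ s, H (σ s) = H s) → ∑ s ∈ S, H s = m • ∑ s ∈ B, H s := by
  classical
  -- Remove the orbit `O` of one element `s` from `S`, and add `s` to the representatives of the
  -- rest.
  induction S using Finset.strongInduction with
  | H S ih =>
    rcases S.eq_empty_or_nonempty with rfl | ⟨s, hs⟩
    · exact ⟨∅, subset_rfl, fun H _ => by simp⟩
    · have hSk : ∀ k, σ^[k] s ∈ S := fun k => by
        induction k with
        | zero => exact hs
        | succ k ihk => rw [Function.iterate_succ_apply']; exact hS _ ihk
      set O := (Finset.range m).image fun k => σ^[k] s with hO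
      have hOS : O ⊆ S := by
        intro t ht
        obtain ⟨k, -, rfl⟩ := Finset.mem_image.1 ht
        exact hSk k
      have hmem : ∀ k, σ^[k] s ∈ O := fun k => by
        refine Finset.mem_image.2 ⟨k % m, Finset.mem_range.2 (Nat.mod_lt _ hm), ?_⟩
        simp only [← hper s hs, Function.iterate_mod_minimalPeriod_eq]
      have hss : S \ O ⊂ S :=
        Finset.sdiff_ssubset hOS ⟨s, hmem 0⟩
      obtain ⟨B, hBS, hB⟩ := ih (S \ O) hss
        (fun t ht => by
          obtain ⟨htS, htO⟩ := Finset.mem_sdiff.1 ht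
          refine Finset.mem_sdiff.2 ⟨hS t htS, fun h => htO ?_⟩
          obtain ⟨k, -, hk⟩ := Finset.mem_image.1 h
          -- Since `t` is itself periodic, it is an iterate of `σ t`; so `σ t ∈ O` would force `t ∈
          -- O`.
          have h1 : σ^[m] t = t := by
            rw [← hper t htS]; exact Function.iterate_minimalPeriod
          obtain ⟨m', rfl⟩ := Nat.exists_eq_succ_of_ne_zero hm.ne'
          rw [← h1, Function.iterate_succ_apply, ← hk, ← Function.iterate_add_apply]
          exact hmem _)
        (fun t ht => hper t (Finset.mem_sdiff.1 ht).1)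
      have hsB : s ∉ B := fun h => (Finset.mem_sdiff.1 (hBS h)).2 (hmem 0)
      refine ⟨insert s B, Finset.insert_subset hs (hBS.trans Finset.sdiff_subset),
        fun H hH => ?_⟩
      rw [Finset.sum_insert hsB, smul_add, add_comm, ← hB H hH, ← Finset.sum_sdiff hOS]
      congr 1
      have hk : ∀ k, H (σ^[k] s) = H s := fun k => by
        induction k with
        | zero => rfl
        | succ k ihk => rw [Function.iterate_succ_apply', hH, ihk]
      rw [hO, Finset.sum_image]
      · simp [hk]
      · intro i hi j hj h
        rw [← hper s hs] at hi hj
        exact (Function.iterate_eq_iterate_iff_of_lt_minimalPeriod (by simpa using hi)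
          (by simpa using hj)).1 h

/-- The words of length `n` in two letters. -/
def words : ℕ → Finset (List Bool)
  | 0 => {[]}
  | n + 1 => (words n).image (List.cons true) ∪ (words n).image (List.cons false)

theorem mem_words {n : ℕ} {l : List Bool} : l ∈ words n ↔ l.length = n := by
  induction n generalizing l with
  | zero => simp [words]
  | succ n ih =>
    cases l with
    | nil => simp [words]
    | cons a l => cases a <;> simp [words, ih]

/-- The value of a word when `x` and `y` are put for the two letters. -/
def evalWord {R : Type*} [Ring R] (x y : R) (l : List Bool) : R :=
  (l.map fun b => if b then x else y).prod

theorem sum_evalWord {R : Type*} [Ring R] (x y : R) (n : ℕ) :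
    ∑ l ∈ words n, evalWord x y l = (x + y) ^ n := by
  induction n with
  | zero => simp [words, evalWord]
  | succ n ih =>
    rw [words, Finset.sum_union, Finset.sum_image (by simp), Finset.sum_image (by simp), pow_succ',
      ← ih, add_mul, Finset.mul_sum, Finset.mul_sum]
    · simp [evalWord]
    · rw [Finset.disjoint_left]
      simp

/-! ### Values of words modulo commutators. -/

theorem mk_mul_comm {R : Type*} [Ring R] (a b : R) :
    ((a * b : R) : Cocenter R) = ((b * a : R) : Cocenter R) := by
  rw [QuotientAddGroup.eq]
  exact AddSubgroup.subset_closure ⟨b, a, by abel⟩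

theorem mk_mul_pow_comm {R : Type*} [Ring R] (a b : R) (k : ℕ) :
    (((a * b) ^ k : R) : Cocenter R) = (((b * a) ^ k : R) : Cocenter R) := by
  cases k with
  | zero => simp
  | succ k =>
    have h : b * (a * b) ^ k = (b * a) ^ k * b := by
      induction k with
      | zero => simp
      | succ k ih => rw [pow_succ, ← mul_assoc, ih, pow_succ]; simp only [mul_assoc]
    rw [pow_succ', mul_assoc, mk_mul_comm, h, mul_assoc, ← pow_succ]

theorem mk_evalWord_rotate_pow {R : Type*} [Ring R] (x y : R) (l : List Bool) (k : ℕ) :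
    ((evalWord x y (l.rotate 1) ^ k : R) : Cocenter R) =
      ((evalWord x y l ^ k : R) : Cocenter R) := by
  cases l with
  | nil => rfl
  | cons a l =>
    simp only [evalWord, List.rotate_cons_succ, List.rotate_zero, List.map_append, List.map_cons,
      List.map_nil, List.prod_append, List.prod_cons, List.prod_nil, mul_one]
    exact mk_mul_pow_comm _ _ _

theorem iterate_rotate_one (l : List Bool) (k : ℕ) :
    (fun l : List Bool => l.rotate 1)^[k] l = l.rotate k := by
  induction k with
  | zero => simp
  | succ k ih => rw [Function.iterate_succ_apply', ih, List.rotate_rotate]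

/-- Rotation by half the length swaps the two halves, so a fixed word has equal halves. -/
theorem words_filter_rotate (n : ℕ) :
    (words (n + n)).filter (fun l => l.rotate n = l) = (words n).image fun l => l ++ l := by
  ext l
  simp only [Finset.mem_filter, Finset.mem_image, mem_words]
  constructor
  · rintro ⟨hl, h⟩
    refine ⟨l.take n, by simp; omega, ?_⟩
    rw [List.rotate_eq_drop_append_take (by omega)] at h
    have h' : l.drop n ++ l.take n = l.take n ++ l.drop n := h.trans (List.take_append_drop n l).symm
    have := List.append_inj_left h' (by simp; omega)
    conv_rhs => rw [← List.take_append_drop n l, this]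
  · rintro ⟨v, rfl, rfl⟩
    simp

/-- The rotation period of a word of length `2 ^ (n + 1)` is a power of 2: it either divides `2 ^
n`, and the word is a square `l ++ l`, or it equals `2 ^ (n + 1)`. The set `B` represents the orbits
of the second kind and serves all `H` at once. -/
theorem exists_primitive_words (M : Type*) [AddCommMonoid M] (n : ℕ) :
    ∃ B : Finset (List Bool), ∀ H : List Bool → M, (∀ l, H (l.rotate 1) = H l) →
      ∑ l ∈ words (2 ^ (n + 1)), H l =
        ∑ l ∈ words (2 ^ n), H (l ++ l) + 2 ^ (n + 1) • ∑ l ∈ B, H l := by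
  have h2 : 2 ^ (n + 1) = 2 ^ n + 2 ^ n := by ring
  obtain ⟨B, -, hB⟩ := exists_orbit_representatives (M := M) (fun l : List Bool => l.rotate 1)
    (2 ^ (n + 1)) (by positivity)
    ((words (2 ^ (n + 1))).filter fun l => ¬ l.rotate (2 ^ n) = l)
    (fun l hl => by
      simp only [Finset.mem_filter, mem_words, List.length_rotate] at hl ⊢
      refine ⟨hl.1, fun h => hl.2 ?_⟩
      rw [List.rotate_rotate, add_comm, ← List.rotate_rotate] at h
      exact List.rotate_injective 1 h)
    (fun l hl => by
      have : Fact (Nat.Prime 2) := ⟨Nat.prime_two⟩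
      simp only [Finset.mem_filter, mem_words] at hl
      refine Function.minimalPeriod_eq_prime_pow ?_ ?_
      · rw [Function.IsPeriodicPt, Function.IsFixedPt, iterate_rotate_one]
        exact hl.2
      · rw [Function.IsPeriodicPt, Function.IsFixedPt, iterate_rotate_one, ← hl.1,
          List.rotate_length])
  refine ⟨B, fun H hH => ?_⟩
  rw [← hB H hH, ← Finset.sum_filter_add_sum_filter_not _ (fun l => l.rotate (2 ^ n) = l)]
  congr 1
  rw [h2, words_filter_rotate, Finset.sum_image]
  intro u hu v hv h
  exact List.append_inj_left h ((mem_words.1 hu).trans (mem_words.1 hv).symm)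

/-- The expansion of `(x + y) ^ 2 ^ n` into powers of representatives of the primitive cyclic
words, modulo commutators. -/
theorem exists_add_pow_two_pow (R : Type*) [Ring R] :
    ∃ B : ℕ → Finset (List Bool), ∀ (x y : R) (n : ℕ),
      (((x + y) ^ 2 ^ n : R) : Cocenter R) = ((x ^ 2 ^ n : R) : Cocenter R) +
        ((y ^ 2 ^ n : R) : Cocenter R) + ∑ j ∈ Finset.range n, 2 ^ (j + 1) •
          ∑ u ∈ B j, ((evalWord x y u ^ 2 ^ (n - (j + 1)) : R) : Cocenter R) := by
  choose B hB using exists_primitive_words (Cocenter R)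
  refine ⟨B, fun x y n => ?_⟩
  -- The extra exponent `k` makes the induction run: passing from `l ++ l` to `l` halves the length
  -- and raises `k` by one. It ends with the one-letter words, which give the powers of `x` and `y`.
  have key : ∀ k, ∑ l ∈ words (2 ^ n), ((evalWord x y l ^ 2 ^ k : R) : Cocenter R) =
      ((x ^ 2 ^ (n + k) : R) : Cocenter R) + ((y ^ 2 ^ (n + k) : R) : Cocenter R) +
        ∑ j ∈ Finset.range n, 2 ^ (j + 1) •
          ∑ u ∈ B j, ((evalWord x y u ^ 2 ^ (n + k - (j + 1)) : R) : Cocenter R) := by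
    induction n with
    | zero =>
      intro k
      have : words (2 ^ 0) = {[true], [false]} := by decide
      rw [this, Finset.sum_pair (by decide)]
      simp [evalWord]
    | succ n ih =>
      intro k
      rw [hB n _ fun l => mk_evalWord_rotate_pow x y l _, Finset.sum_range_succ, ← add_assoc]
      have h1 : n + 1 + k = n + (k + 1) := by ring
      have h2 : n + (k + 1) - (n + 1) = k := by omega
      rw [h1, h2, ← ih (k + 1)]
      congr 1
      refine Finset.sum_congr rfl fun l _ => ?_
      congr 1
      rw [pow_succ' 2 k, pow_mul]
      simp [evalWord, sq]
  have := key 0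
  simp only [pow_zero, pow_one, add_zero] at this
  rw [← this, ← sum_evalWord]
  exact map_sum (QuotientAddGroup.mk' (commutatorSubgroup R)) _ _

/-! ### Sequences of ghost components of Witt vectors -/

namespace Hesselholt

/-- `Represents w z`: the sequence `z` in `F / [F, F]`, where `F` is the free ring on the set `A`,
is a ghost sequence of a lift of `w`. -/
def Represents (p : ℕ) {A : Type*} [Ring A] (w : Witt p A) (z : ℕ → Cocenter (FreeAlgebra ℤ A)) :
    Prop :=
  ∀ n, ∃ h : (fun i : Fin n => z i) ∈ wittFree p A n,
    w.1 n = QuotientAddGroup.mk (s := (wittRel p A n).addSubgroupOf (wittFree p A n)) ⟨_, h⟩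

section

variable {p : ℕ} {A : Type*} [Ring A]

theorem Represents.zero : Represents p (0 : Witt p A) 0 :=
  fun _ => ⟨zero_mem _, rfl⟩

theorem Represents.add {w w' : Witt p A} {z z' : ℕ → Cocenter (FreeAlgebra ℤ A)}
    (h : Represents p w z) (h' : Represents p w' z') : Represents p (w + w') (z + z') := by
  intro n
  obtain ⟨hz, e⟩ := h n
  obtain ⟨hz', e'⟩ := h' n
  exact ⟨add_mem hz hz', congrArg₂ (· + ·) e e'⟩

theorem Represents.sub {w w' : Witt p A} {z z' : ℕ → Cocenter (FreeAlgebra ℤ A)}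
    (h : Represents p w z) (h' : Represents p w' z') : Represents p (w - w') (z - z') := by
  intro n
  obtain ⟨hz, e⟩ := h n
  obtain ⟨hz', e'⟩ := h' n
  exact ⟨sub_mem hz hz', congrArg₂ (· - ·) e e'⟩

theorem Represents.sum {ι : Type*} (s : Finset ι) {w : ι → Witt p A}
    {z : ι → ℕ → Cocenter (FreeAlgebra ℤ A)} (h : ∀ i ∈ s, Represents p (w i) (z i)) :
    Represents p (∑ i ∈ s, w i) (∑ i ∈ s, z i) := by
  classical
  induction s using Finset.induction_on with
  | empty => exact Represents.zero
  | insert a s ha ih =>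
    rw [Finset.sum_insert ha, Finset.sum_insert ha]
    exact (h a (Finset.mem_insert_self a s)).add
      (ih fun i hi => h i (Finset.mem_insert_of_mem hi))

theorem Represents.verschiebung [Fact p.Prime] {w : Witt p A}
    {z : ℕ → Cocenter (FreeAlgebra ℤ A)} (h : Represents p w z) :
    Represents p (verschiebung p w) fun i => Nat.casesOn i 0 fun k => p • z k := by
  intro n
  cases n with
  | zero =>
    have e : (fun i : Fin 0 => (Nat.casesOn (i : ℕ) 0 fun k => p • z k :
        Cocenter (FreeAlgebra ℤ A))) = 0 := Subsingleton.elim _ _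
    refine ⟨e ▸ zero_mem _, ?_⟩
    refine (congrArg (QuotientAddGroup.mk (s := (wittRel p A 0).addSubgroupOf (wittFree p A 0)))
      (Subtype.ext (Subsingleton.elim _ _) : (0 : wittFree p A 0) = _))
  | succ k =>
    obtain ⟨hz, e⟩ := h k
    have e' : (fun i : Fin (k + 1) => (Nat.casesOn (i : ℕ) 0 fun k => p • z k :
        Cocenter (FreeAlgebra ℤ A))) = Fin.cons 0 (p • fun i : Fin k => z i) := by
      funext i
      refine Fin.cases rfl (fun i => rfl) i
    -- The shift with factor `p` takes ghost vectors to ghost vectors by `ghost_cons`; being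
    -- additive, it respects the groups they generate.
    have h2 : (Fin.cons 0 (p • fun i : Fin k => z i) : Fin (k + 1) → _) ∈
        wittFree p A (k + 1) := by
      have : ∀ v ∈ wittFree p A k, (Fin.cons 0 (p • v) : Fin (k + 1) → _) ∈
          wittFree p A (k + 1) := by
        intro v hv
        induction hv using AddSubgroup.closure_induction with
        | mem v hv =>
          obtain ⟨a, rfl⟩ := hv
          rw [← ghost_cons p k (Fact.out : p.Prime).ne_zero]
          exact AddSubgroup.subset_closure ⟨_, rfl⟩
        | zero =>
          convert zero_mem (wittFree p A (k + 1))
          funext i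
          refine Fin.cases ?_ (fun i => ?_) i <;> simp
        | add a b _ _ ha hb =>
          convert add_mem ha hb
          funext i
          refine Fin.cases ?_ (fun i => ?_) i <;> simp [nsmul_add]
        | neg a _ ha =>
          convert neg_mem ha
          funext i
          refine Fin.cases ?_ (fun i => ?_) i <;> simp
      exact this _ hz
    refine ⟨e' ▸ h2, ?_⟩
    change verschiebungN p k (w.1 k) = _
    rw [e]
    exact congrArg (QuotientAddGroup.mk
      (s := (wittRel p A (k + 1)).addSubgroupOf (wittFree p A (k + 1)))) (Subtype.ext e'.symm)

theorem ghost_single {R : Type*} [Ring R] (hp : p ≠ 0) (n : ℕ) (x : R) :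
    (ghost p n fun i : Fin n => if (i : ℕ) = 0 then x else 0) =
      fun i : Fin n => ((x ^ p ^ (i : ℕ) : R) : Cocenter R) := by
  funext i
  unfold ghost
  congr 1
  have hn : 0 < n := i.pos
  rw [Finset.sum_eq_single (⟨0, hn⟩ : Fin n)]
  · simp
  · intro j _ hj
    have : (j : ℕ) ≠ 0 := fun h => hj (Fin.ext h)
    simp [this, hp]
  · intro h
    exact absurd (Finset.mem_Iic.2 (Fin.le_def.2 (Nat.zero_le _))) h

/-- The lift used in `qN` and the lift `x` have the same image in `A`, so their ghost vectors differ
by a generator of `wittRel`. Arbitrary lifts are needed because sums and words in the free ring are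
not free generators. -/
theorem represents_teichmuller (hp : p ≠ 0) (x : FreeAlgebra ℤ A) :
    Represents p (teichmuller p (freeCover A x)) fun i =>
      ((x ^ p ^ i : FreeAlgebra ℤ A) : Cocenter (FreeAlgebra ℤ A)) := by
  intro n
  rw [← ghost_single hp n x]
  refine ⟨AddSubgroup.subset_closure ⟨_, rfl⟩, ?_⟩
  refine QuotientAddGroup.eq.2 ?_
  refine AddSubgroup.mem_addSubgroupOf.2 (AddSubgroup.subset_closure
    ⟨fun i => if (i : ℕ) = 0 then x else 0,
      fun i => FreeAlgebra.ι ℤ (if (i : ℕ) = 0 then freeCover A x else 0), fun i => ?_, ?_⟩)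
  · have : ∀ a : A, freeCover A (FreeAlgebra.ι ℤ a) = a := fun a =>
      FreeAlgebra.lift_ι_apply (R := ℤ) (id : A → A) a
    rw [this]
    exact (apply_ite _ _ _ _).trans (by rw [map_zero])
  · rw [sub_eq_neg_add]
    rfl

theorem Represents.iterate_verschiebung_teichmuller [Fact p.Prime] (j : ℕ)
    (x : FreeAlgebra ℤ A) :
    Represents p ((Hesselholt.verschiebung p)^[j] (teichmuller p (freeCover A x))) fun i =>
      if j ≤ i then p ^ j • ((x ^ p ^ (i - j) : FreeAlgebra ℤ A) : Cocenter (FreeAlgebra ℤ A))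
      else 0 := by
  induction j with
  | zero => simpa using represents_teichmuller (Fact.out : p.Prime).ne_zero x
  | succ j ih =>
    rw [Function.iterate_succ_apply']
    convert ih.verschiebung using 2 with i
    cases i with
    | zero => simp
    | succ i =>
      by_cases h : j ≤ i
      · simp [h, pow_succ', mul_smul]
      · simp [h]

/-- Turns an identity between the first `n` ghost components into an equality in `Wₙ(A)`, which is
how convergence in `W(A)` is checked. -/
theorem Represents.eq_zero {w : Witt p A} {z : ℕ → Cocenter (FreeAlgebra ℤ A)}
    (h : Represents p w z) {n : ℕ} (hz : ∀ i < n, z i = 0) : w.1 n = 0 := by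
  obtain ⟨hn, e⟩ := h n
  rw [e]
  exact congrArg (QuotientAddGroup.mk (s := (wittRel p A n).addSubgroupOf (wittFree p A n)))
    (Subtype.ext (funext fun i => hz i i.2) : _ = (0 : wittFree p A n))

end

/-- `⟨x + y⟩ - ⟨x⟩ - ⟨y⟩` is a limit of elements in the image of the Verschiebung. -/
theorem exists_tendsto_verschiebung {A : Type*} [Ring A] (x y : A) :
    ∃ v : ℕ → Witt 2 A, Filter.Tendsto (fun n => verschiebung 2 (v n)) Filter.atTop
      (nhds (teichmuller 2 (x + y) - teichmuller 2 x - teichmuller 2 y)) := by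
  obtain ⟨B, hB⟩ := exists_add_pow_two_pow (FreeAlgebra ℤ A)
  obtain ⟨x, rfl⟩ : ∃ x', freeCover A x' = x :=
    ⟨FreeAlgebra.ι ℤ x, FreeAlgebra.lift_ι_apply (R := ℤ) (id : A → A) x⟩
  obtain ⟨y, rfl⟩ : ∃ y', freeCover A y' = y :=
    ⟨FreeAlgebra.ι ℤ y, FreeAlgebra.lift_ι_apply (R := ℤ) (id : A → A) y⟩
  rw [← map_add]
  -- One Verschiebung is split off: `V (v n)` is the partial sum of the terms `V ^ (j + 1) ⟨u⟩` with
  -- `j < n`.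
  refine ⟨fun n => ∑ j ∈ Finset.range n, ∑ u ∈ B j,
    (verschiebung 2)^[j] (teichmuller 2 (freeCover A (evalWord x y u))), ?_⟩
  rw [tendsto_subtype_rng, tendsto_pi_nhds]
  intro n
  -- In the discrete group `Wₙ(A)` the partial sums are constant from `N = n` on.
  refine tendsto_const_nhds.congr' ?_
  filter_upwards [Filter.eventually_ge_atTop n] with N hN
  have h := (((represents_teichmuller two_ne_zero (x + y)).sub
    (represents_teichmuller two_ne_zero x)).sub (represents_teichmuller two_ne_zero y)).sub
    (Represents.sum (Finset.range N) fun j _ => Represents.sum (B j) fun u _ =>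
      Represents.iterate_verschiebung_teichmuller (p := 2) (j + 1) (evalWord x y u))
  have h0 := h.eq_zero (n := n) fun i hi => by
    simp only [Pi.sub_apply, Finset.sum_apply]
    rw [hB, sub_eq_zero, add_assoc, add_sub_cancel_left, add_sub_cancel_left]
    -- The ghost component `i` of `V ^ (j + 1) ⟨u⟩` vanishes for `j ≥ i`, so only `j < i`
    -- contributes.
    rw [← Finset.sum_subset (Finset.range_mono (hi.le.trans hN))]
    · refine Finset.sum_congr rfl fun j hj => ?_
      rw [Finset.smul_sum]
      refine Finset.sum_congr rfl fun u _ => ?_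
      rw [if_pos (Nat.succ_le_of_lt (Finset.mem_range.1 hj))]
    · intro j _ hj
      refine Finset.sum_eq_zero fun u _ => if_neg ?_
      simpa using hj
  simp only [map_sum, ← Function.iterate_succ_apply']
  exact sub_eq_zero.1 h0

end Hesselholt

/-! ### A continuous homomorphism from `HH₀(E(ℤ{X, Y}))` to a discrete group -/

namespace CuntzDeninger

/-- The representation of `ℤ{X, Y}` by upper triangular matrices over `𝔽₂` that reads off the
coefficients of `1`, `X`, `Y` and `X Y`. -/
noncomputable def unitriangularRep : FreeAlgebra ℤ (Fin 2) →+* Matrix (Fin 3) (Fin 3) (ZMod 2) :=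
  (FreeAlgebra.lift ℤ ![Matrix.single 0 1 1, Matrix.single 1 2 1]).toRingHom

/-- Upper triangular matrices with constant diagonal form a subring containing the images of both
generators. -/
theorem exists_unitriangularRep_eq (a : FreeAlgebra ℤ (Fin 2)) :
    ∃ c x y z : ZMod 2, unitriangularRep a = !![c, x, z; 0, c, y; 0, 0, c] := by
  induction a using FreeAlgebra.induction with
  | grade0 r =>
    refine ⟨r, 0, 0, 0, ?_⟩
    rw [eq_intCast, map_intCast]
    ext i j
    fin_cases i <;> fin_cases j <;> simp [← Matrix.diagonal_intCast]
  | grade1 i =>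
    have h : unitriangularRep (FreeAlgebra.ι ℤ i) =
        ![Matrix.single 0 1 1, Matrix.single 1 2 1] i := FreeAlgebra.lift_ι_apply _ _
    rw [h]
    fin_cases i
    · exact ⟨0, 1, 0, 0, by decide⟩
    · exact ⟨0, 0, 1, 0, by decide⟩
  | mul a b ha hb =>
    obtain ⟨c, x, y, z, h⟩ := ha
    obtain ⟨c', x', y', z', h'⟩ := hb
    rw [map_mul, h, h']
    refine ⟨c * c', c * x' + x * c', c * y' + y * c', c * z' + x * y' + z * c', ?_⟩
    ext i j
    fin_cases i <;> fin_cases j <;> simp [Matrix.mul_apply, Fin.sum_univ_three]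
  | add a b ha hb =>
    obtain ⟨c, x, y, z, h⟩ := ha
    obtain ⟨c', x', y', z', h'⟩ := hb
    rw [map_add, h, h']
    refine ⟨c + c', x + x', y + y', z + z', ?_⟩
    ext i j
    fin_cases i <;> fin_cases j <;> simp

/-- Squares are central in the image of `unitriangularRep`. -/
theorem unitriangularRep_sq_mem_centralizer (a : FreeAlgebra ℤ (Fin 2)) :
    unitriangularRep a ^ 2 ∈
      Subring.centralizer (unitriangularRep.range : Set (Matrix (Fin 3) (Fin 3) (ZMod 2))) := by
  rw [Subring.mem_centralizer_iff]
  rintro _ ⟨b, rfl⟩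
  obtain ⟨c, x, y, z, h⟩ := exists_unitriangularRep_eq a
  obtain ⟨c', x', y', z', h'⟩ := exists_unitriangularRep_eq b
  -- In characteristic 2 the cross terms `2cx`, `2cy`, `2cz` vanish. What remains is a scalar plus a
  -- multiple of the matrix unit at `(0, 2)`, which commutes with every matrix of this shape.
  have hsq : ∀ c x y z : ZMod 2, !![c, x, z; 0, c, y; 0, 0, c] ^ 2 =
      !![c ^ 2, 0, x * y; 0, c ^ 2, 0; 0, 0, c ^ 2] := by decide
  rw [h, hsq, h']
  ext i j
  fin_cases i <;> fin_cases j <;> simp [Matrix.mul_apply, Fin.sum_univ_three] <;> ring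

/-- The component with index `1` of a sequence in `ℤA`, as a matrix. -/
noncomputable def component : Seq (MonoidAlgebra ℤ (FreeAlgebra ℤ (Fin 2))) →+*
    Matrix (Fin 3) (Fin 3) (ZMod 2) :=
  (unitriangularRep.comp (augment _)).comp (Pi.evalRingHom (fun _ => _) 1)

theorem component_apply (x : Seq (MonoidAlgebra ℤ (FreeAlgebra ℤ (Fin 2)))) :
    component x = unitriangularRep (augment _ (x 1)) := rfl

theorem component_teich (a : MonoidAlgebra ℤ (FreeAlgebra ℤ (Fin 2))) :
    component (teich 2 a) = unitriangularRep (augment _ a) ^ 2 := by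
  rw [component_apply, teich, pow_one, map_pow, map_pow]

theorem V_apply_succ {R : Type*} [Ring R] (p : ℕ) (x : Seq R) (k : ℕ) :
    V p x (k + 1) = p * x k := rfl

theorem component_V (x : Seq (MonoidAlgebra ℤ (FreeAlgebra ℤ (Fin 2)))) :
    component (V 2 x) = 0 := by
  rw [component_apply, V_apply_succ, map_mul, map_mul, map_natCast, map_natCast]
  have : ((2 : ℕ) : Matrix (Fin 3) (Fin 3) (ZMod 2)) = 0 := by decide
  rw [this, zero_mul]

theorem isOpen_component_preimage (S : Set (Matrix (Fin 3) (Fin 3) (ZMod 2))) :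
    IsOpen (component ⁻¹' S) := by
  let _ : TopologicalSpace (MonoidAlgebra ℤ (FreeAlgebra ℤ (Fin 2))) := ⊥
  have _ : DiscreteTopology (MonoidAlgebra ℤ (FreeAlgebra ℤ (Fin 2))) := ⟨rfl⟩
  have h : Continuous fun x : ℕ → MonoidAlgebra ℤ (FreeAlgebra ℤ (Fin 2)) => x 1 :=
    continuous_apply 1
  exact (isOpen_discrete ((unitriangularRep.comp (augment _)) ⁻¹' S)).preimage h

/-- Generators with `m ≥ 1` are killed by the factor 2, and preimages under `component` are closed,
so only products of Teichmüller elements need checking. -/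
theorem component_mem_of_mem_closedSpan
    (I : Ideal (MonoidAlgebra ℤ (FreeAlgebra ℤ (Fin 2))))
    (S : AddSubgroup (Matrix (Fin 3) (Fin 3) (ZMod 2)))
    (hS : ∀ l : List (MonoidAlgebra ℤ (FreeAlgebra ℤ (Fin 2))), (∃ a ∈ l, a ∈ I) →
      component (l.map (teich 2)).prod ∈ S)
    {x : Seq (MonoidAlgebra ℤ (FreeAlgebra ℤ (Fin 2)))} (hx : x ∈ closedSpan 2 I) :
    component x ∈ S := by
  have hclosed : IsClosed (component ⁻¹' (S : Set (Matrix (Fin 3) (Fin 3) (ZMod 2)))) :=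
    isOpen_compl_iff.1 <| Set.preimage_compl ▸
      isOpen_component_preimage (S : Set (Matrix (Fin 3) (Fin 3) (ZMod 2)))ᶜ
  refine AddSubgroup.topologicalClosure_minimal (t := S.comap component.toAddMonoidHom) _
    ((AddSubgroup.closure_le _).2 ?_) hclosed hx
  rintro _ ⟨m, l, hl, rfl⟩
  cases m with
  | zero => exact hS l hl
  | succ m =>
    rw [Function.iterate_succ_apply']
    change component _ ∈ S
    rw [component_V]
    exact zero_mem S

/-- A factor `⟨a⟩` with `a` in the kernel of `augment` contributes the square of zero. -/
theorem component_eq_zero {x : Seq (MonoidAlgebra ℤ (FreeAlgebra ℤ (Fin 2)))}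
    (hx : x ∈ closedSpan 2 (RingHom.ker (augment (FreeAlgebra ℤ (Fin 2))))) :
    component x = 0 := by
  refine AddSubgroup.mem_bot.1 (component_mem_of_mem_closedSpan _ ⊥ ?_ hx)
  rintro l ⟨a, hal, ha⟩
  rw [AddSubgroup.mem_bot, map_list_prod]
  refine List.prod_eq_zero (List.mem_map.2 ⟨_, List.mem_map_of_mem hal, ?_⟩)
  rw [component_teich, (RingHom.mem_ker).1 ha, map_zero, zero_pow two_ne_zero]

/-- On `X(ℤA)` the values are generated by products of squares, which centralize the whole image of
`unitriangularRep`. -/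
theorem component_mul_comm (x y : X 2 (MonoidAlgebra ℤ (FreeAlgebra ℤ (Fin 2)))) :
    component x * component y = component y * component x := by
  have h : component x ∈
      (Subring.centralizer (unitriangularRep.range : Set (Matrix (Fin 3) (Fin 3) (ZMod 2)))) := by
    refine component_mem_of_mem_closedSpan ⊤ (Subring.centralizer _).toAddSubgroup ?_ x.2
    intro l _
    rw [map_list_prod]
    refine Subring.list_prod_mem _ fun m hm => ?_
    obtain ⟨_, ha, rfl⟩ := List.mem_map.1 hm
    obtain ⟨a, -, rfl⟩ := List.mem_map.1 ha
    rw [component_teich]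
    exact unitriangularRep_sq_mem_centralizer _
  exact (Subring.mem_centralizer_iff.1 h _ ⟨_, rfl⟩).symm

/-- The homomorphism of `E(ℤ{X, Y})` that is induced by `component`. -/
noncomputable def componentE :
    E 2 (FreeAlgebra ℤ (Fin 2)) →+* Matrix (Fin 3) (Fin 3) (ZMod 2) :=
  Ideal.Quotient.lift (XI 2 (RingHom.ker (augment (FreeAlgebra ℤ (Fin 2)))))
    (component.comp (X 2 _).subtype) fun _ hx => component_eq_zero hx

theorem componentE_toE (x : X 2 (MonoidAlgebra ℤ (FreeAlgebra ℤ (Fin 2)))) :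
    componentE (toE 2 x) = component x := rfl

theorem toE_surjective : Function.Surjective (toE 2 (A := FreeAlgebra ℤ (Fin 2))) :=
  Ideal.Quotient.mk_surjective

theorem isOpen_componentE_preimage (S : Set (Matrix (Fin 3) (Fin 3) (ZMod 2))) :
    IsOpen (componentE ⁻¹' S) :=
  isOpen_coinduced.2 ((isOpen_component_preimage S).preimage continuous_subtype_val)

/-- The homomorphism of `HH₀(E(ℤ{X, Y}))` that is induced by `component`. -/
noncomputable def componentHH0 :
    HH0E 2 (FreeAlgebra ℤ (Fin 2)) →+ Matrix (Fin 3) (Fin 3) (ZMod 2) :=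
  QuotientAddGroup.lift _ componentE.toAddMonoidHom <| by
    -- The kernel of `componentE` is closed, so containing the commutators it contains the closure
    -- of the group they generate.
    refine AddSubgroup.topologicalClosure_minimal _ ((AddSubgroup.closure_le _).2 ?_)
      (isOpen_compl_iff.1 (isOpen_componentE_preimage {0}ᶜ))
    rintro _ ⟨a, b, rfl⟩
    obtain ⟨a, rfl⟩ := toE_surjective a
    obtain ⟨b, rfl⟩ := toE_surjective b
    change componentE (toE 2 a * toE 2 b - toE 2 b * toE 2 a) = 0
    rw [map_sub, map_mul, map_mul, componentE_toE, componentE_toE, component_mul_comm, sub_self]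

theorem isOpen_componentHH0_preimage (S : Set (Matrix (Fin 3) (Fin 3) (ZMod 2))) :
    IsOpen (componentHH0 ⁻¹' S) :=
  isOpen_coinduced.2 (isOpen_componentE_preimage S)

theorem componentHH0_verschiebung (e : E 2 (FreeAlgebra ℤ (Fin 2))) :
    componentHH0 (toHH0E 2 (verschiebung 2 e)) = 0 := by
  obtain ⟨x, rfl⟩ := toE_surjective e
  exact component_V x

theorem componentHH0_teichmuller (a : FreeAlgebra ℤ (Fin 2)) :
    componentHH0 (toHH0E 2 (teichmuller 2 a)) = unitriangularRep a ^ 2 := by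
  refine (component_teich _).trans ?_
  congr 2
  exact (MonoidAlgebra.lift_of (MonoidHom.id _) a)

end CuntzDeninger

/-! ### The contradiction. -/

theorem theorem2 :
    ¬ ∃ Φ : Hesselholt.Witt 2 (FreeAlgebra ℤ (Fin 2)) →+
        CuntzDeninger.HH0E 2 (FreeAlgebra ℤ (Fin 2)),
      Continuous Φ ∧
      (∀ a, Φ (Hesselholt.teichmuller 2 a) =
        CuntzDeninger.toHH0E 2 (CuntzDeninger.teichmuller 2 a)) ∧
      (∀ w, ∃ e : CuntzDeninger.E 2 (FreeAlgebra ℤ (Fin 2)),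
        CuntzDeninger.toHH0E 2 e = Φ w ∧
        CuntzDeninger.toHH0E 2 (CuntzDeninger.verschiebung 2 e) =
          Φ (Hesselholt.verschiebung 2 w)) := by
  rintro ⟨Φ, hΦ, hT, hV⟩
  obtain ⟨v, hv⟩ := Hesselholt.exists_tendsto_verschiebung
    (FreeAlgebra.ι ℤ (0 : Fin 2)) (FreeAlgebra.ι ℤ (1 : Fin 2))
  -- The fibre of `componentHH0 ∘ Φ` through the defect is open, so it contains some `V (v n)`.
  have hopen := (CuntzDeninger.isOpen_componentHH0_preimage
    {CuntzDeninger.componentHH0 (Φ (Hesselholt.teichmuller 2 (FreeAlgebra.ι ℤ 0 + FreeAlgebra.ι ℤ 1)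
      - Hesselholt.teichmuller 2 (FreeAlgebra.ι ℤ 0)
      - Hesselholt.teichmuller 2 (FreeAlgebra.ι ℤ 1)))}).preimage hΦ
  obtain ⟨n, hn⟩ := (hv.eventually (hopen.mem_nhds rfl)).exists
  obtain ⟨e, -, he⟩ := hV (v n)
  have h : CuntzDeninger.componentHH0 (Φ (Hesselholt.verschiebung 2 (v n))) =
      CuntzDeninger.componentHH0 (Φ (_ - _ - _)) := hn
  -- The side of `V (v n)` is now zero; the other side is `(S + T) ^ 2 - S ^ 2 - T ^ 2 = ST + TS`
  -- for the images `S`, `T` of the generators, where `TS = 0` and `ST ≠ 0`.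
  rw [← he, CuntzDeninger.componentHH0_verschiebung] at h
  simp only [map_sub, hT, CuntzDeninger.componentHH0_teichmuller, map_add] at h
  have hX : CuntzDeninger.unitriangularRep (FreeAlgebra.ι ℤ 0) = Matrix.single 0 1 1 :=
    FreeAlgebra.lift_ι_apply _ _
  have hY : CuntzDeninger.unitriangularRep (FreeAlgebra.ι ℤ 1) = Matrix.single 1 2 1 :=
    FreeAlgebra.lift_ι_apply _ _
  rw [hX, hY] at h
  revert h
  decide
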